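/- Let $\mathcal{H}$ be a complex Hilbert space. A bounded operator $T$ on $\mathcal{H}$ is a contraction if $\|T\| \le 1$; a contraction $T$ is called pure if $\|T^{*m}h\| \to 0$ as $m \to \infty$ for every $h \in \mathcal{H}$, and a pure isometry is an isometry that is a pure contraction. Proposition 3.2. Let $V$ and $T$ be commuting contractions on $\mathcal{H}$ such that $V$ is a pure isometry. Then $T$ is a pure contraction if and only if its compression $P_{\ker V^*} T|_{\ker V^*}$, an operator on the closed subspace $\ker V^*$, is a pure contraction, where $P_{\ker V^*}$ denotes the orthogonal projection of $\mathcal{H}$ onto $\ker V^*$. -/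

import Mathlib

open Filter Topology

section PureContractions

variable {H : Type*} [NormedAddCommGroup H] [InnerProductSpace ℂ H] [CompleteSpace H]

/-- A contraction: a bounded operator of norm at most one. -/
def IsContraction (T : H →L[ℂ] H) : Prop :=
  ‖T‖ ≤ 1

/-- A pure contraction: a contraction `T` whose adjoint powers `T*^m` tend to zero in the strong
operator topology. -/
def IsPureContraction (T : H →L[ℂ] H) : Prop :=
  IsContraction T ∧
    ∀ h : H, Tendsto (fun m : ℕ => ‖((ContinuousLinearMap.adjoint T) ^ m) h‖) atTop (𝓝 0)

/-- A pure isometry: an isometry that is a pure contraction. -/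
def IsPureIsometry (V : H →L[ℂ] H) : Prop :=
  Isometry V ∧ IsPureContraction V

end PureContractions

/-- The compression `P_K T|_K` of `T` to a (closed) subspace `K`, as an operator on `K`. -/
noncomputable def compression {H : Type*} [NormedAddCommGroup H] [InnerProductSpace ℂ H]
    (K : Submodule ℂ H) [K.HasOrthogonalProjection] (T : H →L[ℂ] H) : K →L[ℂ] K :=
  K.orthogonalProjectionOnto ∘L T ∘L K.subtypeL

open ContinuousLinearMap

section Adjoint

variable {H : Type*} [NormedAddCommGroup H] [InnerProductSpace ℂ H]

/-! `T*` commutes with `V*`, so it leaves `ker V*` invariant, and the adjoint of the compression is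
`T*` restricted there; this gives the forward direction. Conversely, purity of `V` makes the union
of the `ker V*^n` dense. Decay of `T*`-orbits spreads from `ker V*` to each `ker V*^n` by induction,
then to `H` by `tendsto_norm_pow_apply_of_approx`. -/

/-- Powers of an operator of norm at most one do not increase norms. -/
theorem norm_pow_apply_le_of_norm_le_one {A : H →L[ℂ] H} (hA : ‖A‖ ≤ 1) (m : ℕ) (x : H) :
    ‖(A ^ m) x‖ ≤ ‖x‖ := by
  induction m with
  | zero => simp
  | succ n ih =>
    rw [pow_succ', mul_apply_eq_comp]
    exact (A.le_of_opNorm_le hA _).trans (by simpa using ih)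

/-- If the orbit of `x` under a contraction `A` comes arbitrarily close to vectors with orbits
tending to zero, then it tends to zero itself. -/
theorem tendsto_norm_pow_apply_of_approx {A : H →L[ℂ] H} (hA : ‖A‖ ≤ 1) {x : H}
    (h : ∀ ε > 0, ∃ k : ℕ, ∃ y : H, ‖(A ^ k) x - y‖ < ε ∧
      Tendsto (fun m : ℕ => ‖(A ^ m) y‖) atTop (𝓝 0)) :
    Tendsto (fun m : ℕ => ‖(A ^ m) x‖) atTop (𝓝 0) := by
  rw [Metric.tendsto_atTop]
  intro ε hε
  obtain ⟨k, y, hy, hlim⟩ := h (ε / 2) (half_pos hε)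
  obtain ⟨N, hN⟩ := Metric.tendsto_atTop.1 hlim (ε / 2) (half_pos hε)
  refine ⟨N + k, fun m hm => ?_⟩
  obtain ⟨n, rfl⟩ := Nat.exists_eq_add_of_le' (le_of_add_le_right hm)
  have hn := hN n (by omega)
  have hdecomp : (A ^ (n + k)) x = (A ^ n) ((A ^ k) x - y) + (A ^ n) y := by
    rw [map_sub, sub_add_cancel, pow_add, mul_apply_eq_comp]
  have h1 := norm_pow_apply_le_of_norm_le_one hA n ((A ^ k) x - y)
  have h2 := norm_add_le ((A ^ n) ((A ^ k) x - y)) ((A ^ n) y)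
  simp only [dist_zero_right, norm_norm] at hn ⊢
  rw [hdecomp]
  linarith

theorem IsContraction.compression {T : H →L[ℂ] H} (hT : IsContraction T) (K : Submodule ℂ H)
    [CompleteSpace K] : IsContraction (compression K T) := by
  refine opNorm_le_bound _ zero_le_one fun x => ?_
  rw [one_mul]
  calc ‖K.orthogonalProjectionOnto (T x)‖ ≤ ‖T x‖ := K.norm_orthogonalProjectionOnto_apply_le _
    _ ≤ ‖x‖ := by simpa using T.le_of_opNorm_le hT x

/-- On an invariant subspace, powers of the compression are restrictions of powers. -/
theorem coe_compression_pow_apply {K : Submodule ℂ H} [CompleteSpace K] {A : H →L[ℂ] H}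
    (hA : ∀ x ∈ K, A x ∈ K) (m : ℕ) (x : K) :
    ((compression K A ^ m) x : H) = (A ^ m) (x : H) := by
  induction m with
  | zero => simp
  | succ m ih =>
    rw [pow_succ', pow_succ', mul_apply_eq_comp, mul_apply_eq_comp, ← ih]
    exact Submodule.starProjection_eq_self_iff.2 (hA _ (Subtype.property _))

variable [CompleteSpace H]

theorem adjoint_apply_apply_of_isometry {V : H →L[ℂ] H} (hV : Isometry V) (x : H) :
    adjoint V (V x) = x := by
  have h := (norm_map_iff_adjoint_comp_self V).1 fun x => hV.norm_map_of_map_zero (map_zero V) x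
  exact DFunLike.congr_fun h x

theorem adjoint_pow_apply_pow_apply_of_isometry {V : H →L[ℂ] H} (hV : Isometry V) (n : ℕ)
    (x : H) : (adjoint V ^ n) ((V ^ n) x) = x := by
  induction n with
  | zero => simp
  | succ n ih =>
    rw [pow_succ, pow_succ', mul_apply_eq_comp, mul_apply_eq_comp,
      adjoint_apply_apply_of_isometry hV, ih]

/-- If the orbits of a contraction `A` commuting with the adjoint of an isometry `V` tend to zero
on the kernel of `V*`, then they do so on the kernel of every power of `V*`. -/
theorem tendsto_norm_pow_apply_of_adjoint_pow_apply_eq_zero {V A : H →L[ℂ] H} (hV : Isometry V)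
    (hA : ‖A‖ ≤ 1) (hVA : Commute (adjoint V) A)
    (hker : ∀ x, adjoint V x = 0 → Tendsto (fun m : ℕ => ‖(A ^ m) x‖) atTop (𝓝 0))
    (n : ℕ) {x : H} (hx : (adjoint V ^ n) x = 0) :
    Tendsto (fun m : ℕ => ‖(A ^ m) x‖) atTop (𝓝 0) := by
  induction n generalizing x with
  | zero =>
    obtain rfl : x = 0 := by simpa using hx
    simp
  | succ n ih =>
    rw [pow_succ, mul_apply_eq_comp] at hx
    refine tendsto_norm_pow_apply_of_approx hA fun ε hε => ?_
    obtain ⟨k, hk⟩ := ((ih hx).eventually_lt_const hε).exists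
    -- The witness is the projection of `A^k x` onto `ker V*`; the error `V V* A^k x` has norm `‖A^k
    -- V* x‖`, small by induction since `V* x` is killed by `V*^n`.
    refine ⟨k, (A ^ k) x - V (adjoint V ((A ^ k) x)), ?_, hker _ ?_⟩
    · have hcomm : adjoint V ((A ^ k) x) = (A ^ k) (adjoint V x) :=
        DFunLike.congr_fun (hVA.pow_right k).eq x
      rwa [sub_sub_cancel, hV.norm_map_of_map_zero (map_zero V), hcomm]
    · rw [map_sub, adjoint_apply_apply_of_isometry hV, sub_self]

/-- If the orbits of a contraction `A` commuting with the adjoint of a pure isometry `V` tend to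
zero on the kernel of `V*`, then they do so everywhere. -/
theorem IsPureIsometry.tendsto_norm_pow_apply {V A : H →L[ℂ] H} (hV : IsPureIsometry V)
    (hA : ‖A‖ ≤ 1) (hVA : Commute (adjoint V) A)
    (hker : ∀ x, adjoint V x = 0 → Tendsto (fun m : ℕ => ‖(A ^ m) x‖) atTop (𝓝 0)) (x : H) :
    Tendsto (fun m : ℕ => ‖(A ^ m) x‖) atTop (𝓝 0) := by
  refine tendsto_norm_pow_apply_of_approx hA fun ε hε => ?_
  obtain ⟨n, hn⟩ := ((hV.2.2 x).eventually_lt_const hε).exists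
  -- The projection of `x` onto `ker V*^n`; the error is at most `‖V*^n x‖`, small by purity of `V`.
  refine ⟨0, x - (V ^ n) ((adjoint V ^ n) x), ?_,
    tendsto_norm_pow_apply_of_adjoint_pow_apply_eq_zero hV.1 hA hVA hker n ?_⟩
  · rw [pow_zero, one_apply_eq_self, sub_sub_cancel]
    exact (norm_pow_apply_le_of_norm_le_one hV.2.1 n _).trans_lt hn
  · rw [map_sub, adjoint_pow_apply_pow_apply_of_isometry hV.1, sub_self]

theorem adjoint_compression (K : Submodule ℂ H) [CompleteSpace K] (T : H →L[ℂ] H) :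
    adjoint (compression K T) = compression K (adjoint T) := by
  rw [compression, compression, adjoint_comp, adjoint_comp, Submodule.adjoint_subtypeL,
    Submodule.adjoint_orthogonalProjectionOnto, comp_assoc]

end Adjoint

theorem proposition3p2 {H : Type*} [NormedAddCommGroup H] [InnerProductSpace ℂ H]
    [CompleteSpace H] (V T : H →L[ℂ] H) (hV : IsPureIsometry V) (hT : IsContraction T)
    (hVT : V ∘L T = T ∘L V) :
    IsPureContraction T ↔
      IsPureContraction (compression (ContinuousLinearMap.adjoint V).ker T) := by
  have hcomm : Commute (adjoint V) (adjoint T) := by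
    have h := congrArg adjoint hVT
    rw [adjoint_comp, adjoint_comp] at h
    exact h.symm
  have hinv : ∀ x ∈ (adjoint V).ker, adjoint T x ∈ (adjoint V).ker := fun x hx => by
    have h : adjoint V (adjoint T x) = adjoint T (adjoint V x) := DFunLike.congr_fun hcomm.eq x
    have hx0 : adjoint V x = 0 := hx
    exact h.trans (by rw [hx0, map_zero])
  have hpow : ∀ (m : ℕ) (x : (adjoint V).ker),
      ‖(adjoint (compression (adjoint V).ker T) ^ m) x‖ = ‖(adjoint T ^ m) (x : H)‖ := fun m x => by
    rw [adjoint_compression, Submodule.coe_norm, coe_compression_pow_apply hinv]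
  refine ⟨fun h => ⟨hT.compression _, fun x => ?_⟩, fun h => ⟨hT, ?_⟩⟩
  · simpa only [hpow] using h.2 x
  · refine hV.tendsto_norm_pow_apply ((adjoint.norm_map T).trans_le hT) hcomm fun x hx => ?_
    simpa only [hpow] using h.2 ⟨x, hx⟩
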